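/- Let $n>1$ and let $A(t)=[a_{ij}(t)]$, $t=0,1,2,\dots$, be real $n\times n$ matrices for which there is a $\beta>0$ such that, for all $t$ and $i,j$: $a_{ii}(t)>0$, $\sum_{k=1}^n|a_{ik}(t)|=1$, and $|a_{ij}(t)|\ge\beta$ whenever $a_{ij}(t)\neq 0$. Consider the system $x(t+1)=A(t)x(t)$, $x(t)\in\mathbb R^n$. The neighbor graph $\mathbb G(t)$ is the signed digraph on $\{1,\dots,n\}$ with an arc from $i$ to $j$ whenever $a_{ji}(t)\ne 0$, carrying the sign of $a_{ji}(t)$. A signed digraph is structurally balanced if its vertices can be partitioned into two sets (one of them possibly empty) such that arcs inside each set are positive and arcs between the two sets are negative; otherwise it is structurally unbalanced. Let $\bar A(t)=[\bar a_{ij}(t)]$ be the $2n\times 2n$ stochastic matrix with $\bar a_{ij}(t)=\bar a_{i+n,j+n}(t)=\max\{0,a_{ij}(t)\}$ and $\bar a_{i+n,j}(t)=\bar a_{i,j+n}(t)=\max\{0,-a_{ij}(t)\}$ for $i,j\in\{1,\dots,n\}$; its graph has an arc from $i$ to $j$ whenever $\bar a_{ji}(t)\neq0$. An absolute probability sequence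 for $\{\bar A(t)\}$ is a sequence of stochastic vectors $\pi(t)$ with $\pi(t)'=\pi(t+1)'\bar A(t)$ for all $t$. Let $\bar p^*(t)$ be the length of the longest shortest directed path of spanning trees contained in the graph of $\bar A(t)$, that is, the maximum over all vertices $r$ and $v$ of the length of the shortest among the directed paths from $r$ to $v$ in the directed spanning trees with root $r$ contained in this graph, and let $\bar p^*=\max_t\bar p^*(t)$. Suppose that every neighbor graph $\mathbb G(t)$ is strongly connected (disregarding signs) and structurally unbalanced. Then $\{\bar A(t)\}$ has an absolute probability sequence, the maximum $\bar p^*$ exists and is positive, and for every absolute probability sequence $\{\pi(t)\}$ for $\{\bar A(t)\}$ the uniform lower bound $\bar\delta=\inf_{t,i}\pi_i(t)$ is positive and the system converges to zero, for all initial conditions, as fast as $\bar\rho^{\,t}$ converges to zero, where $$\bar\rho=1-\frac{\bar\delta\beta^2}{4\bar p^*}\in(0,1);$$ that is, there is a constant $C$, not depending on the initial condition, such that $\|x(t)\|_\infty\le C\,\|x(0)\|_\infty\,\bar\rho^{\,t}$ for all $t\ge0$ and every solution $x$. -/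

import Mathlib

namespace Altafini

/-! ### Directed graphs -/

/-- `p 0, p 1, …, p m` is a directed path of length `m` from `u` to `v` in `G`: consecutive vertices
are joined by arcs and all the vertices are distinct. -/
structure IsDirectedPath {V : Type*} (G : Digraph V) (u v : V) (m : ℕ) (p : ℕ → V) : Prop where
  source : p 0 = u
  target : p m = v
  arc : ∀ k < m, G.Adj (p k) (p (k + 1))
  distinct : Set.InjOn p (Set.Iic m)

/-- There is a directed path between each ordered pair of distinct vertices. -/
def StronglyConnected {V : Type*} (G : Digraph V) : Prop :=
  ∀ u v : V, u ≠ v → ∃ (m : ℕ) (p : ℕ → V), IsDirectedPath G u v m p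

/-- `T` is a directed spanning tree of `G` with root `r`: no arc of `T` enters `r`, at most one arc
of `T` enters each vertex, and every vertex is reached from `r` by a directed path of `T`. -/
structure IsSpanningTree {V : Type*} (T G : Digraph V) (r : V) : Prop where
  le : T ≤ G
  root : ∀ u, ¬ T.Adj u r
  unique : ∀ u u' v, T.Adj u v → T.Adj u' v → u = u'
  reach : ∀ v, ∃ (m : ℕ) (p : ℕ → V), IsDirectedPath T r v m p

/-- The length of the shortest among the directed paths from `r` to `v` in the spanning trees of `G`
with root `r`. -/
noncomputable def shortestTreePath {V : Type*} (G : Digraph V) (r v : V) : ℕ :=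
  sInf {m | ∃ (T : Digraph V) (p : ℕ → V), IsSpanningTree T G r ∧ IsDirectedPath T r v m p}

/-- The length of the longest shortest directed path of spanning trees contained in `G`: the
maximum of `shortestTreePath G r v` over all roots `r` and all vertices `v`. -/
noncomputable def longestShortestTreePath {V : Type*} [Fintype V] (G : Digraph V) : ℕ :=
  Finset.univ.sup fun q : V × V => shortestTreePath G q.1 q.2

/-- The graph of a (nonnegative) matrix `M`: there is an arc from `i` to `j` when the `ji` entry of
`M` is nonzero. -/
def matrixGraph {V : Type*} (M : Matrix V V ℝ) : Digraph V where
  Adj i j := M j i ≠ 0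

/-! ### Signed directed graphs -/

/-- A signed digraph, given by its arcs with sign `+` and its arcs with sign `-`. -/
structure SignedDigraph (V : Type*) where
  pos : Digraph V
  neg : Digraph V

/-- The digraph obtained by forgetting the signs. -/
def SignedDigraph.unsigned {V : Type*} (G : SignedDigraph V) : Digraph V where
  Adj i j := G.pos.Adj i j ∨ G.neg.Adj i j

/-- The vertices can be partitioned into two sets (`S` and its complement, one of which may be
empty) such that arcs inside a set are positive and arcs between the two sets are negative. -/
def SignedDigraph.StructurallyBalanced {V : Type*} (G : SignedDigraph V) : Prop :=
  ∃ S : Set V, (∀ i j, G.pos.Adj i j → (i ∈ S ↔ j ∈ S)) ∧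
    (∀ i j, G.neg.Adj i j → ¬ (i ∈ S ↔ j ∈ S))

/-- Not structurally balanced. -/
def SignedDigraph.StructurallyUnbalanced {V : Type*} (G : SignedDigraph V) : Prop :=
  ¬ G.StructurallyBalanced

/-- The neighbor graph of a weight matrix `A`: there is an arc from `i` to `j` when `A j i` is
nonzero, and its sign is the sign of `A j i`. -/
def neighborGraph {V : Type*} (A : Matrix V V ℝ) : SignedDigraph V where
  pos := ⟨fun i j => 0 < A j i⟩
  neg := ⟨fun i j => A j i < 0⟩

/-! ### The discrete-time Altafini model -/

/-- The standing assumption on the weights: positive diagonal entries, absolute row sums `1`, and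
the nonzero entries are bounded below by `β > 0` in absolute value. -/
structure WeightAssumption {n : ℕ} (A : ℕ → Matrix (Fin n) (Fin n) ℝ) (β : ℝ) : Prop where
  diag_pos : ∀ t i, 0 < A t i i
  row_sum : ∀ t i, ∑ j, |A t i j| = 1
  beta_pos : 0 < β
  lower : ∀ t i j, 0 < |A t i j| → β ≤ |A t i j|

/-- `x` is a trajectory of the system `x(t+1) = A(t) x(t)`. -/
def IsTrajectory {n : ℕ} (A : ℕ → Matrix (Fin n) (Fin n) ℝ) (x : ℕ → Fin n → ℝ) : Prop :=
  ∀ t, x (t + 1) = (A t).mulVec (x t)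

/-- The lifted `2n × 2n` matrix, with blocks `max {0, a_ij}` on the diagonal and `max {0, -a_ij}`
off the diagonal. The index `Sum.inl i` stands for `i` and `Sum.inr i` for `i + n`. -/
noncomputable def lift {n : ℕ} (A : Matrix (Fin n) (Fin n) ℝ) :
    Matrix (Fin n ⊕ Fin n) (Fin n ⊕ Fin n) ℝ :=
  Matrix.fromBlocks (A.map fun a => max 0 a) (A.map fun a => max 0 (-a))
    (A.map fun a => max 0 (-a)) (A.map fun a => max 0 a)

/-- `π` is an absolute probability sequence for `S`: each `π t` is a stochastic vector, and
`π(t)' = π(t+1)' S(t)` for all `t`. -/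
structure IsAbsoluteProbabilitySequence {V : Type*} [Fintype V] (S : ℕ → Matrix V V ℝ)
    (π : ℕ → V → ℝ) : Prop where
  stochastic : ∀ t, π t ∈ stdSimplex ℝ V
  eq : ∀ t, π t = Matrix.vecMul (π (t + 1)) (S t)

/-- The largest uniform lower bound on the entries of the vectors `π t`. -/
noncomputable def uniformLowerBound {V : Type*} (π : ℕ → V → ℝ) : ℝ :=
  ⨅ q : ℕ × V, π q.1 q.2

/-- The maximum over `t` of the longest shortest directed path of spanning trees contained in the
graph of the lifted matrix at time `t`. -/
noncomputable def pStar {n : ℕ} (A : ℕ → Matrix (Fin n) (Fin n) ℝ) : ℕ :=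
  ⨆ t, longestShortestTreePath (matrixGraph (lift (A t)))

/-- The rate `1 - δ β² / (4 p)`. -/
noncomputable def rate (β δ : ℝ) (p : ℕ) : ℝ :=
  1 - δ * β ^ 2 / (4 * (p : ℝ))

end Altafini

namespace Altafini

open Finset

/-! The vector `z = (x, -x)` evolves under the stochastic matrices `lift (A t)`, so the signed
system becomes an averaging system on a doubled vertex set. Strong connectivity and structural
unbalance make the doubled graph strongly connected (`lift_reach`), which keeps the entries of every
absolute probability sequence uniformly positive (`pow_mul_le`). The comparison function is `W(t) =
∑ π_k(t) z_k(t)²`. Its one-step drop is a weighted sum of the variances of `z` under the rows of the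
lifted matrix (`sum_sq_sub_sum_sq_eq`). Each variance dominates the squared differences along
incoming arcs, and Cauchy–Schwarz along a path turns these into the squared difference of its
endpoints. For a path joining the two copies of a coordinate of maximal modulus this is `4‖x‖² ≥ W`,
so `W` contracts by `ρ²` at each step. Finally `δ‖x‖² ≤ W ≤ ‖x‖²` transfers the decay to `x`. -/

/-! ### Directed graphs: walks and spanning trees -/

/-- `v` is reached from `r` by a walk with `k` arcs. -/
def WalkIn {V : Type*} (G : Digraph V) (r : V) : ℕ → V → Prop
  | 0, v => v = r
  | k + 1, v => ∃ u, WalkIn G r k u ∧ G.Adj u v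

lemma exists_walkIn {V : Type*} {G : Digraph V} {r v : V}
    (h : Relation.ReflTransGen G.Adj r v) : ∃ k, WalkIn G r k v := by
  induction h with
  | refl => exact ⟨0, rfl⟩
  | tail _ hbc ih =>
    obtain ⟨k, hk⟩ := ih
    exact ⟨k + 1, _, hk, hbc⟩

lemma IsDirectedPath.reflTransGen {V : Type*} {G : Digraph V} {u v : V} {m : ℕ} {p : ℕ → V}
    (h : IsDirectedPath G u v m p) : Relation.ReflTransGen G.Adj u v := by
  have key : ∀ k ≤ m, Relation.ReflTransGen G.Adj u (p k) := by
    intro k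
    induction k with
    | zero => intro _; rw [h.source]
    | succ k ih => intro hk; exact (ih (by omega)).tail (h.arc k (by omega))
  simpa [h.target] using key m le_rfl

lemma IsDirectedPath.mono {V : Type*} {T G : Digraph V} (hle : T ≤ G) {u v : V} {m : ℕ}
    {p : ℕ → V} (h : IsDirectedPath T u v m p) : IsDirectedPath G u v m p :=
  ⟨h.source, h.target, fun k hk => hle (h.arc k hk), h.distinct⟩

lemma IsDirectedPath.length_lt {V : Type*} [Fintype V] {G : Digraph V} {u v : V} {m : ℕ}
    {p : ℕ → V} (h : IsDirectedPath G u v m p) : m < Fintype.card V := by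
  classical
  have hinj : Set.InjOn p (Finset.range (m + 1) : Finset ℕ) := by
    intro a ha b hb hab
    simp only [Finset.coe_range, Set.mem_Iio] at ha hb
    exact h.distinct (Set.mem_Iic.2 (by omega)) (Set.mem_Iic.2 (by omega)) hab
  have := Finset.card_le_univ ((Finset.range (m + 1)).image p)
  rw [Finset.card_image_of_injOn hinj, Finset.card_range] at this
  omega

/-- Otherwise the complement of `s` would be closed under arcs, and `a` could not reach `b`. -/
lemma exists_arc_into {V : Type*} {G : Digraph V} (h : ∀ u v, Relation.ReflTransGen G.Adj u v)
    {s : Set V} {a b : V} (ha : a ∉ s) (hb : b ∈ s) : ∃ u v, u ∉ s ∧ v ∈ s ∧ G.Adj u v := by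
  by_contra! hno
  have : ∀ v, Relation.ReflTransGen G.Adj a v → v ∉ s := by
    intro v hv
    induction hv with
    | refl => exact ha
    | tail _ hbc ih => exact fun hc => hno _ _ ih hc hbc
  exact this b (h a b) hb

/-- Breadth-first tree: each vertex other than `r` takes a parent strictly closer to `r`. -/
lemma exists_isSpanningTree {V : Type*} {G : Digraph V} {r : V}
    (h : ∀ v, Relation.ReflTransGen G.Adj r v) : ∃ T, IsSpanningTree T G r := by
  classical
  have hw : ∀ v, ∃ k, WalkIn G r k v := fun v => exists_walkIn (h v)
  let d : V → ℕ := fun v => Nat.find (hw v)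
  have hpar : ∀ v, ∃ u, v ≠ r → G.Adj u v ∧ d u < d v := by
    intro v
    by_cases hv : v = r
    · exact ⟨r, fun h => absurd hv h⟩
    have hspec : WalkIn G r (d v) v := Nat.find_spec (hw v)
    rcases hd : d v with _ | k
    · rw [hd] at hspec; exact absurd hspec hv
    · rw [hd] at hspec
      obtain ⟨u, hu, huv⟩ := hspec
      exact ⟨u, fun _ => ⟨huv, Nat.lt_succ_of_le (Nat.find_min' (hw u) hu)⟩⟩
  choose par hpar using hpar
  let T : Digraph V := ⟨fun u v => v ≠ r ∧ u = par v⟩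
  -- The bound on `d` along the path keeps vertices distinct when `v` is appended: all earlier ones
  -- are strictly closer to `r`.
  have hreach : ∀ N v, d v = N → ∃ (m : ℕ) (p : ℕ → V), IsDirectedPath T r v m p ∧
      ∀ k ≤ m, d (p k) ≤ d v := by
    intro N
    induction N using Nat.strong_induction_on with
    | _ N ih =>
      intro v hv
      by_cases hr : v = r
      · refine ⟨0, fun _ => r, ⟨rfl, hr.symm, fun k hk => absurd hk (by omega), ?_⟩, ?_⟩
        · intro a ha b hb _
          simp only [Set.mem_Iic] at ha hb
          omega
        · intro k _; rw [hr]
      · obtain ⟨-, hlt⟩ := hpar v hr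
        obtain ⟨m, p, hp, hle⟩ := ih (d (par v)) (hv ▸ hlt) (par v) rfl
        refine ⟨m + 1, fun k => if k ≤ m then p k else v, ⟨?_, ?_, ?_, ?_⟩, ?_⟩
        · simp [hp.source]
        · simp
        · intro k hk
          rcases Nat.lt_succ_iff_lt_or_eq.1 hk with hk' | rfl
          · simpa [hk'.le, Nat.succ_le_of_lt hk'] using hp.arc k hk'
          · simp only [le_refl, if_true, Nat.not_succ_le_self, if_false]
            exact ⟨hr, hp.target⟩
        · intro a ha b hb hab
          simp only [Set.mem_Iic] at ha hb
          by_cases ha' : a ≤ m <;> by_cases hb' : b ≤ m <;>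
            simp only [ha', hb', if_true, if_false] at hab
          · exact hp.distinct ha' hb' hab
          · have := hle a ha'; rw [hab] at this; omega
          · have := hle b hb'; rw [← hab] at this; omega
          · omega
        · intro k _
          by_cases hk : k ≤ m
          · simp only [hk, if_true]; exact (hle k hk).trans hlt.le
          · simp [hk]
  refine ⟨T, ?_, ?_, ?_, ?_⟩
  · rintro u v ⟨hv, rfl⟩
    exact (hpar v hv).1
  · rintro u ⟨hv, -⟩
    exact hv rfl
  · rintro u u' v ⟨-, rfl⟩ ⟨-, rfl⟩
    rfl
  · intro v
    obtain ⟨m, p, hp, -⟩ := hreach _ v rfl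
    exact ⟨m, p, hp⟩

/-- Reachability makes the set of lengths nonempty, so its `sInf` is attained rather than the
default `0`. -/
lemma exists_isDirectedPath_shortestTreePath {V : Type*} {G : Digraph V} {r : V}
    (h : ∀ v, Relation.ReflTransGen G.Adj r v) (v : V) :
    ∃ p, IsDirectedPath G r v (shortestTreePath G r v) p := by
  obtain ⟨T, hT⟩ := exists_isSpanningTree h
  obtain ⟨m, p, hp⟩ := hT.reach v
  have hne : {m | ∃ (T : Digraph V) (p : ℕ → V),
      IsSpanningTree T G r ∧ IsDirectedPath T r v m p}.Nonempty := ⟨m, T, p, hT, hp⟩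
  obtain ⟨T', p', hT', hp'⟩ := Nat.sInf_mem hne
  exact ⟨p', hp'.mono hT'.le⟩

lemma shortestTreePath_le_card {V : Type*} [Fintype V] (G : Digraph V) (r v : V) :
    shortestTreePath G r v ≤ Fintype.card V := by
  rcases Set.eq_empty_or_nonempty {m | ∃ (T : Digraph V) (p : ℕ → V),
      IsSpanningTree T G r ∧ IsDirectedPath T r v m p} with he | hne
  · rw [shortestTreePath, he]
    simp
  · obtain ⟨T, p, -, hp⟩ := Nat.sInf_mem hne
    exact hp.length_lt.le

lemma longestShortestTreePath_le_card {V : Type*} [Fintype V] (G : Digraph V) :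
    longestShortestTreePath G ≤ Fintype.card V :=
  Finset.sup_le fun q _ => shortestTreePath_le_card G q.1 q.2

lemma shortestTreePath_le_longest {V : Type*} [Fintype V] (G : Digraph V) (r v : V) :
    shortestTreePath G r v ≤ longestShortestTreePath G :=
  Finset.le_sup (f := fun q : V × V => shortestTreePath G q.1 q.2) (Finset.mem_univ (r, v))

lemma shortestTreePath_pos {V : Type*} {G : Digraph V} {r v : V}
    (h : ∀ v, Relation.ReflTransGen G.Adj r v) (hrv : r ≠ v) : 0 < shortestTreePath G r v := by
  obtain ⟨p, hp⟩ := exists_isDirectedPath_shortestTreePath h v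
  refine Nat.pos_of_ne_zero fun h0 => hrv ?_
  rw [← hp.source, ← hp.target, h0]

/-! ### The graph of the lifted matrix -/

section Lift

variable {n : ℕ}

@[simp] lemma lift_adj_inl_inl (A : Matrix (Fin n) (Fin n) ℝ) (i j : Fin n) :
    (matrixGraph (lift A)).Adj (.inl i) (.inl j) ↔ 0 < A j i := by
  simp [matrixGraph, lift]

@[simp] lemma lift_adj_inr_inr (A : Matrix (Fin n) (Fin n) ℝ) (i j : Fin n) :
    (matrixGraph (lift A)).Adj (.inr i) (.inr j) ↔ 0 < A j i := by
  simp [matrixGraph, lift]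

@[simp] lemma lift_adj_inl_inr (A : Matrix (Fin n) (Fin n) ℝ) (i j : Fin n) :
    (matrixGraph (lift A)).Adj (.inl i) (.inr j) ↔ A j i < 0 := by
  simp [matrixGraph, lift]

@[simp] lemma lift_adj_inr_inl (A : Matrix (Fin n) (Fin n) ℝ) (i j : Fin n) :
    (matrixGraph (lift A)).Adj (.inr i) (.inl j) ↔ A j i < 0 := by
  simp [matrixGraph, lift]

lemma lift_adj_swap {A : Matrix (Fin n) (Fin n) ℝ} {a b : Fin n ⊕ Fin n}
    (h : (matrixGraph (lift A)).Adj a b) : (matrixGraph (lift A)).Adj a.swap b.swap := by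
  rcases a with i | i <;> rcases b with j | j <;> simpa using h

lemma lift_reach_swap {A : Matrix (Fin n) (Fin n) ℝ} {a b : Fin n ⊕ Fin n}
    (h : Relation.ReflTransGen (matrixGraph (lift A)).Adj a b) :
    Relation.ReflTransGen (matrixGraph (lift A)).Adj a.swap b.swap :=
  Relation.ReflTransGen.lift Sum.swap (fun _ _ => lift_adj_swap) _ _ h

/-- A walk lifts to the doubled graph, changing copy at each negative arc. -/
lemma lift_reach_or {A : Matrix (Fin n) (Fin n) ℝ} {i j : Fin n}
    (h : Relation.ReflTransGen (neighborGraph A).unsigned.Adj i j) :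
    Relation.ReflTransGen (matrixGraph (lift A)).Adj (.inl i) (.inl j) ∨
      Relation.ReflTransGen (matrixGraph (lift A)).Adj (.inl i) (.inr j) := by
  induction h with
  | refl => exact Or.inl .refl
  | @tail b c _ hbc ih =>
    rcases ih with ih | ih <;> rcases hbc with hbc | hbc
    · exact Or.inl (ih.tail ((lift_adj_inl_inl A b c).2 hbc))
    · exact Or.inr (ih.tail ((lift_adj_inl_inr A b c).2 hbc))
    · exact Or.inr (ih.tail ((lift_adj_inr_inr A b c).2 hbc))
    · exact Or.inl (ih.tail ((lift_adj_inr_inl A b c).2 hbc))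

lemma StronglyConnected.reflTransGen {V : Type*} {G : Digraph V} (h : StronglyConnected G)
    (u v : V) : Relation.ReflTransGen G.Adj u v := by
  by_cases huv : u = v
  · rw [huv]
  · obtain ⟨m, p, hp⟩ := h u v huv
    exact hp.reflTransGen

/-- If `inr i` were out of reach, each vertex would be reached in exactly one copy, and the copy
reached would give a balancing partition. -/
lemma lift_reach_opposite {A : Matrix (Fin n) (Fin n) ℝ}
    (hconn : StronglyConnected (neighborGraph A).unsigned)
    (hunb : (neighborGraph A).StructurallyUnbalanced) (i : Fin n) :
    Relation.ReflTransGen (matrixGraph (lift A)).Adj (.inl i) (.inr i) := by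
  set R := Relation.ReflTransGen (matrixGraph (lift A)).Adj with hR
  by_contra hno
  have hor : ∀ j, R (.inl i) (.inl j) ∨ R (.inl i) (.inr j) :=
    fun j => lift_reach_or (hconn.reflTransGen i j)
  -- Reaching both copies of `j` allows a return to `i` from either one; by the swap symmetry one of
  -- them ends at `inr i`.
  have hnot : ∀ j, R (.inl i) (.inl j) → ¬ R (.inl i) (.inr j) := by
    intro j h1 h2
    rcases lift_reach_or (hconn.reflTransGen j i) with h | h
    · exact hno (h2.trans (by simpa using lift_reach_swap h))
    · exact hno (h1.trans h)
  refine hunb ⟨{j | R (.inl i) (.inl j)}, ?_, ?_⟩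
  · intro j k hjk
    constructor
    · intro h
      exact h.tail ((lift_adj_inl_inl A j k).2 hjk)
    · intro h
      refine (hor j).resolve_right fun h' => hnot k h ?_
      exact h'.tail ((lift_adj_inr_inr A j k).2 hjk)
  · intro j k hjk hiff
    rcases hor j with h | h
    · exact hnot k (hiff.1 h) (h.tail ((lift_adj_inl_inr A j k).2 hjk))
    · exact hnot j (hiff.2 (h.tail ((lift_adj_inr_inl A j k).2 hjk))) h

lemma lift_reach {A : Matrix (Fin n) (Fin n) ℝ}
    (hconn : StronglyConnected (neighborGraph A).unsigned)
    (hunb : (neighborGraph A).StructurallyUnbalanced) (a b : Fin n ⊕ Fin n) :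
    Relation.ReflTransGen (matrixGraph (lift A)).Adj a b := by
  have hopp := lift_reach_opposite hconn hunb
  have hopp' : ∀ i, Relation.ReflTransGen (matrixGraph (lift A)).Adj (.inr i) (.inl i) :=
    fun i => by simpa using lift_reach_swap (hopp i)
  have hll : ∀ i j, Relation.ReflTransGen (matrixGraph (lift A)).Adj (.inl i) (.inl j) := by
    intro i j
    rcases lift_reach_or (hconn.reflTransGen i j) with h | h
    · exact h
    · exact h.trans (hopp' j)
  rcases a with i | i <;> rcases b with j | j
  · exact hll i j
  · exact (hll i j).trans (hopp j)
  · exact (hopp' i).trans (hll i j)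
  · exact ((hopp' i).trans (hll i j)).trans (hopp j)

/-! ### Stochastic matrices -/

/-- Nonnegative entries and unit row sums. -/
structure IsStochastic {V : Type*} [Fintype V] (M : Matrix V V ℝ) : Prop where
  nonneg : ∀ i j, 0 ≤ M i j
  row_sum : ∀ i, ∑ j, M i j = 1

lemma max_add_max_neg (a : ℝ) : max 0 a + max 0 (-a) = |a| := by
  rcases le_total 0 a with h | h
  · rw [max_eq_right h, max_eq_left (by linarith), abs_of_nonneg h, add_zero]
  · rw [max_eq_left h, max_eq_right (by linarith), abs_of_nonpos h, zero_add]

lemma max_sub_max_neg (a : ℝ) : max 0 a - max 0 (-a) = a := by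
  rcases le_total 0 a with h | h
  · rw [max_eq_right h, max_eq_left (by linarith), sub_zero]
  · rw [max_eq_left h, max_eq_right (by linarith), zero_sub, neg_neg]

lemma WeightAssumption.isStochastic_lift {A : ℕ → Matrix (Fin n) (Fin n) ℝ} {β : ℝ}
    (hA : WeightAssumption A β) (t : ℕ) : IsStochastic (lift (A t)) where
  nonneg i j := by
    rcases i with i | i <;> rcases j with j | j <;> simp [lift]
  row_sum i := by
    rw [Fintype.sum_sum_type]
    rcases i with i | i
    · simp only [lift, Matrix.fromBlocks_apply₁₁, Matrix.fromBlocks_apply₁₂, Matrix.map_apply]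
      rw [← Finset.sum_add_distrib, ← hA.row_sum t i]
      exact Finset.sum_congr rfl fun j _ => max_add_max_neg _
    · simp only [lift, Matrix.fromBlocks_apply₂₁, Matrix.fromBlocks_apply₂₂, Matrix.map_apply]
      rw [← Finset.sum_add_distrib, ← hA.row_sum t i]
      exact Finset.sum_congr rfl fun j _ => by rw [add_comm, max_add_max_neg]

lemma le_max_zero_of_ne {a β : ℝ} (h : 0 < |a| → β ≤ |a|) (ha : max 0 a ≠ 0) :
    β ≤ max 0 a := by
  have h0 : 0 < a := by
    by_contra hn
    exact ha (max_eq_left (not_lt.1 hn))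
  rw [max_eq_right h0.le]
  simpa [abs_of_pos h0] using h (abs_pos.2 h0.ne')

lemma WeightAssumption.le_lift {A : ℕ → Matrix (Fin n) (Fin n) ℝ} {β : ℝ}
    (hA : WeightAssumption A β) (t : ℕ) {i j : Fin n ⊕ Fin n} (h : lift (A t) i j ≠ 0) :
    β ≤ lift (A t) i j := by
  have hneg : ∀ i j, 0 < |-(A t i j)| → β ≤ |-(A t i j)| := by
    intro i j
    rw [abs_neg]
    exact hA.lower t i j
  rcases i with i | i <;> rcases j with j | j
  · exact le_max_zero_of_ne (hA.lower t i j) h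
  · exact le_max_zero_of_ne (hneg i j) h
  · exact le_max_zero_of_ne (hneg i j) h
  · exact le_max_zero_of_ne (hA.lower t i j) h

lemma WeightAssumption.lift_diag {A : ℕ → Matrix (Fin n) (Fin n) ℝ} {β : ℝ}
    (hA : WeightAssumption A β) (t : ℕ) (i : Fin n ⊕ Fin n) : β ≤ lift (A t) i i := by
  refine hA.le_lift t ?_
  rcases i with i | i
  · simpa [lift] using hA.diag_pos t i
  · simpa [lift] using hA.diag_pos t i

/-- Antisymmetric vectors are invariant under the lift, since `a` is the difference of its positive
and negative parts. -/
lemma lift_mulVec_elim_neg (A : Matrix (Fin n) (Fin n) ℝ) (x : Fin n → ℝ) :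
    (lift A).mulVec (Sum.elim x (-x)) = Sum.elim (A.mulVec x) (-(A.mulVec x)) := by
  ext i
  rcases i with i | i
  · simp only [lift, Matrix.mulVec, dotProduct, Fintype.sum_sum_type, Matrix.fromBlocks_apply₁₁,
      Matrix.fromBlocks_apply₁₂, Matrix.map_apply, Sum.elim_inl, Sum.elim_inr, Pi.neg_apply]
    rw [← Finset.sum_add_distrib]
    refine Finset.sum_congr rfl fun j _ => ?_
    nth_rw 3 [← max_sub_max_neg (A i j)]
    ring
  · simp only [lift, Matrix.mulVec, dotProduct, Fintype.sum_sum_type, Matrix.fromBlocks_apply₂₁,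
      Matrix.fromBlocks_apply₂₂, Matrix.map_apply, Sum.elim_inl, Sum.elim_inr, Pi.neg_apply]
    rw [← Finset.sum_add_distrib, ← Finset.sum_neg_distrib]
    refine Finset.sum_congr rfl fun j _ => ?_
    nth_rw 3 [← max_sub_max_neg (A i j)]
    ring

end Lift

/-! ### Absolute probability sequences -/

section Absolute

variable {V : Type*} [Fintype V]

lemma IsStochastic.vecMul_mem {M : Matrix V V ℝ} (hM : IsStochastic M) {w : V → ℝ}
    (hw : w ∈ stdSimplex ℝ V) : Matrix.vecMul w M ∈ stdSimplex ℝ V := by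
  refine ⟨fun j => Finset.sum_nonneg fun i _ => mul_nonneg (hw.1 i) (hM.nonneg i j), ?_⟩
  simp only [Matrix.vecMul, dotProduct]
  rw [Finset.sum_comm]
  simp only [← Finset.mul_sum, hM.row_sum, mul_one, hw.2]

/-- The recursion runs backward in time, so any vector prescribed at time `T` determines the earlier
ones. -/
lemma exists_finite_absoluteProbabilitySequence [Nonempty V] {S : ℕ → Matrix V V ℝ}
    (hS : ∀ t, IsStochastic (S t)) (T : ℕ) :
    ∃ π : ℕ → V → ℝ, (∀ t, π t ∈ stdSimplex ℝ V) ∧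
      ∀ t < T, π t = Matrix.vecMul (π (t + 1)) (S t) := by
  classical
  obtain ⟨w, hw⟩ : ∃ w, w ∈ stdSimplex ℝ V :=
    ⟨_, single_mem_stdSimplex ℝ (Classical.arbitrary V)⟩
  induction T generalizing S with
  | zero => exact ⟨fun _ => w, fun _ => hw, fun t ht => absurd ht (by omega)⟩
  | succ T ih =>
    obtain ⟨π, hπ, hπ'⟩ := ih (S := fun t => S (t + 1)) fun t => hS (t + 1)
    refine ⟨fun t => Nat.casesOn t (Matrix.vecMul (π 0) (S 0)) π, ?_, ?_⟩
    · rintro (_ | t)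
      · exact (hS 0).vecMul_mem (hπ 0)
      · exact hπ t
    · rintro (_ | t) ht
      · rfl
      · exact hπ' t (by omega)

/-- Compactness: the sets `K T` are nested, nonempty and closed in a product of simplices, so they
have a common point. -/
lemma exists_isAbsoluteProbabilitySequence [Nonempty V] {S : ℕ → Matrix V V ℝ}
    (hS : ∀ t, IsStochastic (S t)) : ∃ π, IsAbsoluteProbabilitySequence S π := by
  let K : ℕ → Set (ℕ → V → ℝ) := fun T => {π | (∀ t, π t ∈ stdSimplex ℝ V) ∧
      ∀ t < T, π t = Matrix.vecMul (π (t + 1)) (S t)}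
  have hclosed : ∀ T, IsClosed (K T) := by
    intro T
    have h1 : IsClosed {π : ℕ → V → ℝ | ∀ t, π t ∈ stdSimplex ℝ V} :=
      Set.ofPred_forall _ ▸ isClosed_iInter fun t =>
        (isClosed_stdSimplex ℝ V).preimage (continuous_apply t)
    have h2 : IsClosed {π : ℕ → V → ℝ | ∀ t < T, π t = Matrix.vecMul (π (t + 1)) (S t)} := by
      rw [Set.ofPred_forall]
      refine isClosed_iInter fun t => ?_
      rw [Set.ofPred_forall]
      refine isClosed_iInter fun _ => isClosed_eq (continuous_apply t) ?_
      exact Continuous.matrix_vecMul (continuous_apply (t + 1)) continuous_const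
    exact h1.inter h2
  have hcompact : IsCompact (Set.univ.pi fun _ : ℕ => stdSimplex ℝ V) :=
    isCompact_univ_pi fun _ => isCompact_stdSimplex ℝ V
  have hK0 : IsCompact (K 0) := hcompact.of_isClosed_subset (hclosed 0)
    fun π hπ t _ => hπ.1 t
  obtain ⟨π, hπ⟩ := IsCompact.nonempty_iInter_of_sequence_nonempty_isCompact_isClosed K
    (fun T π hπ => ⟨hπ.1, fun t ht => hπ.2 t (by omega)⟩)
    (fun T => exists_finite_absoluteProbabilitySequence hS T) hK0 hclosed
  rw [Set.mem_iInter] at hπ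
  exact ⟨π, (hπ 0).1, fun t => (hπ (t + 1)).2 t (by omega)⟩

/-! ### Uniform positivity of absolute probability sequences -/

lemma IsAbsoluteProbabilitySequence.mul_le {S : ℕ → Matrix V V ℝ} {π : ℕ → V → ℝ}
    (hπ : IsAbsoluteProbabilitySequence S π) (hS : ∀ t, IsStochastic (S t)) (t : ℕ) (i k : V) :
    π (t + 1) k * S t k i ≤ π t i := by
  rw [congrFun (hπ.eq t) i]
  exact Finset.single_le_sum (f := fun k => π (t + 1) k * S t k i)
    (fun k _ => mul_nonneg ((hπ.stochastic (t + 1)).1 k) ((hS t).nonneg k i)) (Finset.mem_univ k)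

/-- Some entry is always at least the average. One step back in time, large entries survive up to a
factor `β` thanks to the diagonal, and an arc entering the set of large entries adds its tail to it.
-/
lemma IsAbsoluteProbabilitySequence.card_le [Nonempty V] {S : ℕ → Matrix V V ℝ}
    {π : ℕ → V → ℝ} {β : ℝ} (hπ : IsAbsoluteProbabilitySequence S π)
    (hS : ∀ t, IsStochastic (S t)) (hβ : 0 < β) (hdiag : ∀ t i, β ≤ S t i i)
    (hlow : ∀ t i j, S t i j ≠ 0 → β ≤ S t i j)
    (hconn : ∀ t u v, Relation.ReflTransGen (matrixGraph (S t)).Adj u v) (s t : ℕ) :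
    min (s + 1) (Fintype.card V) ≤
      #{k | β ^ s * (Fintype.card V : ℝ)⁻¹ ≤ π t k} := by
  classical
  induction s generalizing t with
  | zero =>
    have : ∃ k ∈ (Finset.univ : Finset V), (Fintype.card V : ℝ)⁻¹ ≤ π t k := by
      refine Finset.exists_le_of_sum_le Finset.univ_nonempty ?_
      simp [(hπ.stochastic t).2]
    obtain ⟨k, -, hk⟩ := this
    refine (min_le_left _ _).trans (Finset.card_pos.2 ⟨k, ?_⟩)
    simpa using hk
  | succ s ih =>
    set c := (Fintype.card V : ℝ)⁻¹
    have hstep : ∀ i k, S t k i ≠ 0 → β ^ s * c ≤ π (t + 1) k → β ^ (s + 1) * c ≤ π t i := by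
      intro i k hne hk
      refine le_trans ?_ (hπ.mul_le hS t i k)
      calc β ^ (s + 1) * c = (β ^ s * c) * β := by ring
        _ ≤ π (t + 1) k * S t k i :=
          mul_le_mul hk (hlow t k i hne) hβ.le ((hπ.stochastic (t + 1)).1 k)
    have hsub : ({k | β ^ s * c ≤ π (t + 1) k} : Finset V) ⊆
        ({k | β ^ (s + 1) * c ≤ π t k} : Finset V) := by
      intro k hk
      simp only [Finset.mem_filter, Finset.mem_univ, true_and] at hk ⊢
      exact hstep k k (hβ.trans_le (hdiag t k)).ne' hk
    have hih := ih (t + 1)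
    by_cases hall : ∀ k, β ^ s * c ≤ π (t + 1) k
    · rw [Finset.filter_true_of_mem fun k _ => hall k] at hsub
      exact (min_le_right _ _).trans (Finset.card_le_card hsub)
    · push Not at hall
      obtain ⟨a, ha⟩ := hall
      have hpos : 0 < #{k | β ^ s * c ≤ π (t + 1) k} :=
        lt_of_lt_of_le (lt_min (Nat.succ_pos s) Fintype.card_pos) hih
      obtain ⟨b, hb⟩ := Finset.card_pos.1 hpos
      simp only [Finset.mem_filter, Finset.mem_univ, true_and] at hb
      obtain ⟨u, v, hu, hv, huv⟩ := exists_arc_into (hconn t)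
        (s := {k | β ^ s * c ≤ π (t + 1) k}) (a := a) (b := b) (not_le.2 ha) hb
      have hss : ({k | β ^ s * c ≤ π (t + 1) k} : Finset V) ⊂
          ({k | β ^ (s + 1) * c ≤ π t k} : Finset V) := by
        refine (Finset.ssubset_iff_of_subset hsub).2 ⟨u, ?_, ?_⟩
        · simpa using hstep u v huv hv
        · simpa using hu
      have := Finset.card_lt_card hss
      omega

lemma IsAbsoluteProbabilitySequence.pow_mul_le [Nonempty V] {S : ℕ → Matrix V V ℝ}
    {π : ℕ → V → ℝ} {β : ℝ} (hπ : IsAbsoluteProbabilitySequence S π)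
    (hS : ∀ t, IsStochastic (S t)) (hβ : 0 < β) (hdiag : ∀ t i, β ≤ S t i i)
    (hlow : ∀ t i j, S t i j ≠ 0 → β ≤ S t i j)
    (hconn : ∀ t u v, Relation.ReflTransGen (matrixGraph (S t)).Adj u v) (t : ℕ) (i : V) :
    β ^ Fintype.card V * (Fintype.card V : ℝ)⁻¹ ≤ π t i := by
  have h := hπ.card_le hS hβ hdiag hlow hconn (Fintype.card V) t
  rw [min_eq_right (Nat.le_succ _)] at h
  have huniv := (Finset.card_eq_iff_eq_univ _).1 (le_antisymm (Finset.card_le_univ _) h)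
  have hi := Finset.mem_univ i
  rw [← huniv, Finset.mem_filter] at hi
  exact hi.2

lemma IsAbsoluteProbabilitySequence.uniformLowerBound_le {S : ℕ → Matrix V V ℝ}
    {π : ℕ → V → ℝ} (hπ : IsAbsoluteProbabilitySequence S π) (t : ℕ) (i : V) :
    uniformLowerBound π ≤ π t i :=
  ciInf_le (f := fun q : ℕ × V => π q.1 q.2)
    ⟨0, by rintro _ ⟨q, rfl⟩; exact (hπ.stochastic q.1).1 q.2⟩ (t, i)

/-! ### Decay of the quadratic comparison function -/

/-- Only the terms `i` and `j` of the variance are kept, and `(a - b)² ≤ 2a² + 2b²` eliminates the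
mean. -/
lemma half_sq_mul_sq_sub_le_variance {w z : V → ℝ} (hw : w ∈ stdSimplex ℝ V) {β : ℝ} (hβ : 0 < β)
    {i j : V} (hi : β ≤ w i) (hj : β ≤ w j) :
    β ^ 2 / 2 * (z i - z j) ^ 2 ≤ ∑ k, w k * z k ^ 2 - (∑ k, w k * z k) ^ 2 := by
  classical
  set m := ∑ k, w k * z k with hm
  have hvar : ∑ k, w k * z k ^ 2 - m ^ 2 = ∑ k, w k * (z k - m) ^ 2 := by
    have : ∑ k, w k * (z k - m) ^ 2 =
        ∑ k, w k * z k ^ 2 - 2 * m * ∑ k, w k * z k + m ^ 2 * ∑ k, w k := by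
      rw [Finset.mul_sum _ _ (2 * m), Finset.mul_sum _ _ (m ^ 2), ← Finset.sum_sub_distrib,
        ← Finset.sum_add_distrib]
      exact Finset.sum_congr rfl fun k _ => by ring
    rw [this, hw.2, ← hm]
    ring
  have hnn : ∀ k, 0 ≤ w k * (z k - m) ^ 2 := fun k => mul_nonneg (hw.1 k) (sq_nonneg _)
  rw [hvar]
  by_cases hij : i = j
  · rw [hij]
    simpa using Finset.sum_nonneg fun k _ => hnn k
  have hβ1 : β ≤ 1 := hi.trans (by
    rw [← hw.2]; exact Finset.single_le_sum (fun k _ => hw.1 k) (Finset.mem_univ i))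
  have hpair : w i * (z i - m) ^ 2 + w j * (z j - m) ^ 2 ≤ ∑ k, w k * (z k - m) ^ 2 := by
    rw [← Finset.sum_pair (f := fun k => w k * (z k - m) ^ 2) hij]
    exact Finset.sum_le_univ_sum_of_nonneg hnn
  refine le_trans ?_ hpair
  have h1 : β * (z i - m) ^ 2 ≤ w i * (z i - m) ^ 2 :=
    mul_le_mul_of_nonneg_right hi (sq_nonneg _)
  have h2 : β * (z j - m) ^ 2 ≤ w j * (z j - m) ^ 2 :=
    mul_le_mul_of_nonneg_right hj (sq_nonneg _)
  -- Since `β ≤ 1`, the coefficient `β / 2` may be weakened to the `β ^ 2 / 2` that the rate uses.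
  have h3 : β ^ 2 / 2 * (z i - z j) ^ 2 ≤ β / 2 * (z i - z j) ^ 2 :=
    mul_le_mul_of_nonneg_right (by nlinarith) (sq_nonneg _)
  have h4 : β / 2 * (z i - z j) ^ 2 ≤ β * (z i - m) ^ 2 + β * (z j - m) ^ 2 := by
    nlinarith [mul_nonneg hβ.le (sq_nonneg (z i - m + (z j - m)))]
  linarith

/-- Telescoping and Cauchy–Schwarz; distinctness of the vertices means that each `f i` is counted at
most once. -/
lemma IsDirectedPath.sq_sub_le {G : Digraph V} {u v : V} {m : ℕ} {p : ℕ → V}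
    (hp : IsDirectedPath G u v m p) {z f : V → ℝ} (hf : ∀ i, 0 ≤ f i)
    (hGf : ∀ i j, G.Adj i j → (z j - z i) ^ 2 ≤ f j) :
    (z v - z u) ^ 2 ≤ m * ∑ i, f i := by
  classical
  have htel : z v - z u = ∑ k ∈ Finset.range m, (z (p (k + 1)) - z (p k)) := by
    rw [Finset.sum_range_sub (fun k => z (p k)), hp.source, hp.target]
  have hinj : Set.InjOn (fun k => p (k + 1)) (Finset.range m : Finset ℕ) := by
    intro a ha b hb hab
    simp only [Finset.coe_range, Set.mem_Iio] at ha hb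
    have := hp.distinct (Set.mem_Iic.2 (by omega : a + 1 ≤ m))
      (Set.mem_Iic.2 (by omega : b + 1 ≤ m)) hab
    omega
  calc (z v - z u) ^ 2
      ≤ m * ∑ k ∈ Finset.range m, (z (p (k + 1)) - z (p k)) ^ 2 := by
        rw [htel]
        simpa using sq_sum_le_card_mul_sum_sq (s := Finset.range m)
          (f := fun k => z (p (k + 1)) - z (p k))
    _ ≤ m * ∑ k ∈ Finset.range m, f (p (k + 1)) := by
        refine mul_le_mul_of_nonneg_left (Finset.sum_le_sum fun k hk => ?_) m.cast_nonneg
        exact hGf _ _ (hp.arc k (Finset.mem_range.1 hk))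
    _ ≤ m * ∑ i, f i := by
        refine mul_le_mul_of_nonneg_left ?_ m.cast_nonneg
        rw [← Finset.sum_image (f := f) hinj]
        exact Finset.sum_le_univ_sum_of_nonneg hf

lemma sum_sq_sub_sum_sq_eq {M : Matrix V V ℝ} {w : V → ℝ} (z : V → ℝ) :
    ∑ j, Matrix.vecMul w M j * z j ^ 2 - ∑ i, w i * (M.mulVec z i) ^ 2 =
      ∑ i, w i * (∑ j, M i j * z j ^ 2 - (∑ j, M i j * z j) ^ 2) := by
  simp only [mul_sub, Finset.sum_sub_distrib, Matrix.mulVec, Matrix.vecMul, dotProduct]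
  congr 1
  simp only [Finset.sum_mul, Finset.mul_sum]
  rw [Finset.sum_comm]
  exact Finset.sum_congr rfl fun i _ => Finset.sum_congr rfl fun j _ => by ring

/-- One step of a stochastic matrix with a positive diagonal lowers the weighted sum of squares by
an amount controlled by the spread of the values along any directed path. -/
lemma sum_sq_mulVec_le {M : Matrix V V ℝ} (hM : IsStochastic M) {β δ : ℝ} (hβ : 0 < β)
    (hδ : 0 < δ) (hdiag : ∀ i, β ≤ M i i) (hlow : ∀ i j, M i j ≠ 0 → β ≤ M i j) {w : V → ℝ}
    (hw : ∀ i, δ ≤ w i) (z : V → ℝ) {u v : V} {m : ℕ} {p : ℕ → V}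
    (hp : IsDirectedPath (matrixGraph M) u v m p) {q : ℝ} (hq : 0 < q) (hmq : (m : ℝ) ≤ q) :
    ∑ i, w i * (M.mulVec z i) ^ 2 ≤
      ∑ j, Matrix.vecMul w M j * z j ^ 2 - δ * β ^ 2 / (2 * q) * (z v - z u) ^ 2 := by
  set g : V → ℝ := fun i => ∑ j, M i j * z j ^ 2 - (∑ j, M i j * z j) ^ 2 with hg
  have hrow : ∀ i, M i ∈ stdSimplex ℝ V := fun i => ⟨hM.nonneg i, hM.row_sum i⟩
  have hgarc : ∀ i j, M j i ≠ 0 → β ^ 2 / 2 * (z j - z i) ^ 2 ≤ g j := fun i j h =>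
    half_sq_mul_sq_sub_le_variance (hrow j) hβ (hdiag j) (hlow j i h)
  have hg0 : ∀ i, 0 ≤ g i := fun i => by
    simpa using hgarc i i (hβ.trans_le (hdiag i)).ne'
  have hpath : (z v - z u) ^ 2 ≤ m * ∑ i, 2 / β ^ 2 * g i := by
    refine hp.sq_sub_le (fun i => mul_nonneg (by positivity) (hg0 i)) fun i j h => ?_
    have h' := mul_le_mul_of_nonneg_left (hgarc i j h) (by positivity : (0 : ℝ) ≤ 2 / β ^ 2)
    refine le_of_eq_of_le ?_ h'
    field_simp
  rw [← Finset.mul_sum] at hpath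
  have hG0 : 0 ≤ ∑ i, g i := Finset.sum_nonneg fun i _ => hg0 i
  have hwg : δ * ∑ i, g i ≤ ∑ i, w i * g i := by
    rw [Finset.mul_sum]
    exact Finset.sum_le_sum fun i _ => mul_le_mul_of_nonneg_right (hw i) (hg0 i)
  have hpath' : (z v - z u) ^ 2 ≤ q * (2 / β ^ 2 * ∑ i, g i) :=
    hpath.trans (mul_le_mul_of_nonneg_right hmq (by positivity))
  have hfin : δ * β ^ 2 / (2 * q) * (z v - z u) ^ 2 ≤ δ * ∑ i, g i := by
    refine (mul_le_mul_of_nonneg_left hpath' (by positivity)).trans (le_of_eq ?_)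
    field_simp
  have := sum_sq_sub_sum_sq_eq (M := M) (w := w) z
  linarith

end Absolute

/-! ### The convergence rate -/

section Rate

variable {n : ℕ} {A : ℕ → Matrix (Fin n) (Fin n) ℝ}

/-- A supremum in `ℕ` is a genuine maximum only for a bounded family; otherwise `pStar` would be the
default `0`. -/
lemma bddAbove_longestShortestTreePath (A : ℕ → Matrix (Fin n) (Fin n) ℝ) :
    BddAbove (Set.range fun t => longestShortestTreePath (matrixGraph (lift (A t)))) :=
  ⟨_, by rintro _ ⟨t, rfl⟩; exact longestShortestTreePath_le_card _⟩

lemma shortestTreePath_le_pStar (A : ℕ → Matrix (Fin n) (Fin n) ℝ) (t : ℕ)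
    (r v : Fin n ⊕ Fin n) :
    shortestTreePath (matrixGraph (lift (A t))) r v ≤ pStar A :=
  (shortestTreePath_le_longest _ r v).trans (le_ciSup (bddAbove_longestShortestTreePath A) t)

/-- `1 - 2c ≤ (1 - c)²`: the halved coefficient in `rate` comes from passing from squares to norms.
-/
lemma one_sub_two_mul_le_sq_rate (β δ : ℝ) (p : ℕ) :
    1 - δ * β ^ 2 / (2 * (p : ℝ)) ≤ rate β δ p ^ 2 := by
  have h : δ * β ^ 2 / (2 * (p : ℝ)) = 2 * (δ * β ^ 2 / (4 * (p : ℝ))) := by ring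
  rw [h, rate]
  nlinarith [sq_nonneg (δ * β ^ 2 / (4 * (p : ℝ)))]

lemma sum_elim_neg_sq_le {w : Fin n ⊕ Fin n → ℝ} (hw : w ∈ stdSimplex ℝ (Fin n ⊕ Fin n))
    (x : Fin n → ℝ) : ∑ k, w k * Sum.elim x (-x) k ^ 2 ≤ ‖x‖ ^ 2 := by
  have hz : ∀ k, Sum.elim x (-x) k ^ 2 ≤ ‖x‖ ^ 2 := by
    have hx : ∀ i, x i ^ 2 ≤ ‖x‖ ^ 2 := fun i => by
      rw [← sq_abs (x i)]
      exact pow_le_pow_left₀ (abs_nonneg _) (norm_le_pi_norm x i) 2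
    rintro (i | i) <;> simpa using hx i
  calc ∑ k, w k * Sum.elim x (-x) k ^ 2 ≤ ∑ k, w k * ‖x‖ ^ 2 :=
        Finset.sum_le_sum fun k _ => mul_le_mul_of_nonneg_left (hz k) (hw.1 k)
    _ = ‖x‖ ^ 2 := by rw [← Finset.sum_mul, hw.2, one_mul]

lemma exists_norm_apply_eq [Nonempty (Fin n)] (x : Fin n → ℝ) : ∃ i, ‖x i‖ = ‖x‖ := by
  obtain ⟨i, -, hi⟩ := Finset.exists_max_image Finset.univ (fun i => ‖x i‖) Finset.univ_nonempty
  exact ⟨i, le_antisymm (norm_le_pi_norm x i)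
    ((pi_norm_le_iff_of_nonempty x).2 fun j => hi j (Finset.mem_univ j))⟩

lemma mul_sq_norm_le_sum_elim_neg [Nonempty (Fin n)] {w : Fin n ⊕ Fin n → ℝ} {δ : ℝ} (hδ : 0 < δ)
    (hw : ∀ k, δ ≤ w k) (x : Fin n → ℝ) :
    δ * ‖x‖ ^ 2 ≤ ∑ k, w k * Sum.elim x (-x) k ^ 2 := by
  obtain ⟨i, hi⟩ := exists_norm_apply_eq x
  rw [← hi, Real.norm_eq_abs, sq_abs]
  refine (mul_le_mul_of_nonneg_right (hw (.inl i)) (sq_nonneg _)).trans ?_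
  exact Finset.single_le_sum (f := fun k => w k * Sum.elim x (-x) k ^ 2)
    (fun k _ => mul_nonneg (hδ.le.trans (hw k)) (sq_nonneg _)) (Finset.mem_univ (Sum.inl i))

lemma sum_sq_trajectory_succ_le [Nonempty (Fin n)] {β : ℝ} (hA : WeightAssumption A β)
    (hconn : ∀ t, StronglyConnected (neighborGraph (A t)).unsigned)
    (hunb : ∀ t, (neighborGraph (A t)).StructurallyUnbalanced)
    {π : ℕ → Fin n ⊕ Fin n → ℝ} (hπ : IsAbsoluteProbabilitySequence (fun t => lift (A t)) π)
    (hδ : 0 < uniformLowerBound π) (hp : 0 < pStar A) {x : ℕ → Fin n → ℝ}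
    (hx : IsTrajectory A x) (t : ℕ) :
    ∑ k, π (t + 1) k * Sum.elim (x (t + 1)) (-x (t + 1)) k ^ 2 ≤
      rate β (uniformLowerBound π) (pStar A) ^ 2 *
        ∑ k, π t k * Sum.elim (x t) (-x t) k ^ 2 := by
  obtain ⟨i, hi⟩ := exists_norm_apply_eq (x t)
  -- The endpoints are the two copies of `i`, where the values of `z` differ by `2 * x t i`.
  obtain ⟨p, hpath⟩ := exists_isDirectedPath_shortestTreePath
    (lift_reach (hconn t) (hunb t) (.inr i)) (.inl i)
  have hstep := sum_sq_mulVec_le (hA.isStochastic_lift t) hA.beta_pos hδ (hA.lift_diag t)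
    (fun i j => hA.le_lift t) (fun k => hπ.uniformLowerBound_le (t + 1) k)
    (Sum.elim (x t) (-x t)) hpath (Nat.cast_pos.2 hp)
    (Nat.cast_le.2 (shortestTreePath_le_pStar A t _ _))
  rw [lift_mulVec_elim_neg, ← hx t, ← hπ.eq t] at hstep
  set W := ∑ k, π t k * Sum.elim (x t) (-x t) k ^ 2 with hW
  have hW0 : 0 ≤ W :=
    Finset.sum_nonneg fun k _ => mul_nonneg ((hπ.stochastic t).1 k) (sq_nonneg _)
  -- The right side equals `4‖x t‖²`, so a factor `4` is given away here.
  have hWle : W ≤ (Sum.elim (x t) (-x t) (.inl i) - Sum.elim (x t) (-x t) (.inr i)) ^ 2 := by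
    refine (sum_elim_neg_sq_le (hπ.stochastic t) (x t)).trans ?_
    simp only [Sum.elim_inl, Sum.elim_inr, Pi.neg_apply]
    rw [← hi, Real.norm_eq_abs, sq_abs]
    nlinarith [sq_nonneg (x t i)]
  set c := uniformLowerBound π * β ^ 2 / (2 * (pStar A : ℝ)) with hc
  have hc0 : 0 ≤ c := by
    have := hA.beta_pos
    positivity
  have h1 := mul_le_mul_of_nonneg_left hWle hc0
  have h2 := mul_le_mul_of_nonneg_right
    (one_sub_two_mul_le_sq_rate β (uniformLowerBound π) (pStar A)) hW0
  linarith

lemma pStar_pos [Nonempty (Fin n)] (hconn : ∀ t, StronglyConnected (neighborGraph (A t)).unsigned)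
    (hunb : ∀ t, (neighborGraph (A t)).StructurallyUnbalanced) : 0 < pStar A := by
  have i : Fin n := Classical.arbitrary _
  exact (shortestTreePath_pos (lift_reach (hconn 0) (hunb 0) (.inl i))
    (by simp : (Sum.inl i : Fin n ⊕ Fin n) ≠ .inr i)).trans_le (shortestTreePath_le_pStar A 0 _ _)

lemma WeightAssumption.uniformLowerBound_pos [Nonempty (Fin n)] {β : ℝ}
    (hA : WeightAssumption A β)
    (hconn : ∀ t, StronglyConnected (neighborGraph (A t)).unsigned)
    (hunb : ∀ t, (neighborGraph (A t)).StructurallyUnbalanced)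
    {π : ℕ → Fin n ⊕ Fin n → ℝ} (hπ : IsAbsoluteProbabilitySequence (fun t => lift (A t)) π) :
    0 < uniformLowerBound π := by
  have hβ := hA.beta_pos
  have hcard : 0 < Fintype.card (Fin n ⊕ Fin n) := Fintype.card_pos
  refine lt_of_lt_of_le (by positivity) (le_ciInf fun q => hπ.pow_mul_le hA.isStochastic_lift
    hβ hA.lift_diag (fun t i j => hA.le_lift t)
    (fun t => lift_reach (hconn t) (hunb t)) q.1 q.2)

lemma WeightAssumption.beta_le_one [Nonempty (Fin n)] {β : ℝ} (hA : WeightAssumption A β) :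
    β ≤ 1 := by
  have k : Fin n ⊕ Fin n := Classical.arbitrary _
  have hS := hA.isStochastic_lift 0
  refine (hA.lift_diag 0 k).trans ?_
  rw [← hS.row_sum k]
  exact Finset.single_le_sum (fun j _ => hS.nonneg k j) (Finset.mem_univ k)

lemma IsAbsoluteProbabilitySequence.uniformLowerBound_le_one {V : Type*} [Fintype V] [Nonempty V]
    {S : ℕ → Matrix V V ℝ} {π : ℕ → V → ℝ} (hπ : IsAbsoluteProbabilitySequence S π) :
    uniformLowerBound π ≤ 1 := by
  have k : V := Classical.arbitrary _
  refine (hπ.uniformLowerBound_le 0 k).trans ?_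
  rw [← (hπ.stochastic 0).2]
  exact Finset.single_le_sum (fun j _ => (hπ.stochastic 0).1 j) (Finset.mem_univ k)

lemma rate_pos {β δ : ℝ} {p : ℕ} (hβ : 0 < β) (hβ1 : β ≤ 1) (hδ1 : δ ≤ 1) (hp : 0 < p) :
    0 < rate β δ p := by
  have hp1 : (1 : ℝ) ≤ p := by exact_mod_cast hp
  rw [rate, sub_pos, div_lt_one (by linarith)]
  nlinarith [mul_le_mul_of_nonneg_right hδ1 (sq_nonneg β)]

lemma rate_lt_one {β δ : ℝ} {p : ℕ} (hβ : 0 < β) (hδ : 0 < δ) (hp : 0 < p) :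
    rate β δ p < 1 := by
  rw [rate, sub_lt_self_iff]
  positivity

end Rate

end Altafini

/-! ### The main theorem -/

theorem proposition3 (n : ℕ) (hn : 1 < n) (A : ℕ → Matrix (Fin n) (Fin n) ℝ) (β : ℝ)
    (hA : Altafini.WeightAssumption A β)
    (hconn : ∀ t, Altafini.StronglyConnected (Altafini.neighborGraph (A t)).unsigned)
    (hunb : ∀ t, (Altafini.neighborGraph (A t)).StructurallyUnbalanced) :
    (∃ π, Altafini.IsAbsoluteProbabilitySequence (fun t => Altafini.lift (A t)) π) ∧
    BddAbove (Set.range fun t =>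
      Altafini.longestShortestTreePath (Altafini.matrixGraph (Altafini.lift (A t)))) ∧
    0 < Altafini.pStar A ∧
    ∀ π, Altafini.IsAbsoluteProbabilitySequence (fun t => Altafini.lift (A t)) π →
      0 < Altafini.uniformLowerBound π ∧
      0 < Altafini.rate β (Altafini.uniformLowerBound π) (Altafini.pStar A) ∧
      Altafini.rate β (Altafini.uniformLowerBound π) (Altafini.pStar A) < 1 ∧
      ∃ C : ℝ, ∀ x, Altafini.IsTrajectory A x → ∀ t,
        ‖x t‖ ≤ C * ‖x 0‖ *
          Altafini.rate β (Altafini.uniformLowerBound π) (Altafini.pStar A) ^ t := by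
  have : Nonempty (Fin n) := ⟨⟨0, by omega⟩⟩
  have hp := Altafini.pStar_pos hconn hunb
  refine ⟨Altafini.exists_isAbsoluteProbabilitySequence hA.isStochastic_lift,
    Altafini.bddAbove_longestShortestTreePath A, hp, fun π hπ => ?_⟩
  have hδ := hA.uniformLowerBound_pos hconn hunb hπ
  have hr := Altafini.rate_pos hA.beta_pos hA.beta_le_one hπ.uniformLowerBound_le_one hp
  refine ⟨hδ, hr, Altafini.rate_lt_one hA.beta_pos hδ hp,
    -- This constant comes from taking square roots in `δ‖x t‖² ≤ W(t) ≤ ρ^(2t) ‖x 0‖²`.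
    (√(Altafini.uniformLowerBound π))⁻¹, fun x hx t => ?_⟩
  set δ := Altafini.uniformLowerBound π
  set ρ := Altafini.rate β δ (Altafini.pStar A)
  have hdecay : ∑ k, π t k * Sum.elim (x t) (-x t) k ^ 2 ≤ (ρ ^ t) ^ 2 * ‖x 0‖ ^ 2 := by
    induction t with
    | zero => simpa using Altafini.sum_elim_neg_sq_le (hπ.stochastic 0) (x 0)
    | succ t ih =>
      refine (Altafini.sum_sq_trajectory_succ_le hA hconn hunb hπ hδ hp hx t).trans ?_
      refine (mul_le_mul_of_nonneg_left ih (sq_nonneg ρ)).trans (le_of_eq ?_)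
      ring
  have hlow := (Altafini.mul_sq_norm_le_sum_elim_neg hδ (hπ.uniformLowerBound_le t) (x t)).trans
    hdecay
  have hs : 0 < √δ := Real.sqrt_pos.2 hδ
  have hsq : √δ * ‖x t‖ ≤ ρ ^ t * ‖x 0‖ := by
    refine (sq_le_sq₀ (by positivity) (by positivity)).1 ?_
    rwa [mul_pow, mul_pow, Real.sq_sqrt hδ.le]
  calc ‖x t‖ = (√δ)⁻¹ * (√δ * ‖x t‖) := by field_simp
    _ ≤ (√δ)⁻¹ * (ρ ^ t * ‖x 0‖) := mul_le_mul_of_nonneg_left hsq (by positivity)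
    _ = (√δ)⁻¹ * ‖x 0‖ * ρ ^ t := by ring
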